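/- **Types.** Type 1 objects are functions $f\in\mathbb N^{\mathbb N}$, type 2 objects are total functionals $F:\mathbb N^{\mathbb N}\to\mathbb N$, and type 3 objects are total functionals $\Phi$ taking every type 2 functional to a natural number. **Hyper-sequential functionals.** A *string* is a sequence $\{(f_\beta,a_\beta)\}_{\beta<\alpha}$ with $\alpha$ a countable ordinal, $f_\beta\in\mathbb N^{\mathbb N}$ and $a_\beta\in\mathbb N\cup\{\ast\}$; it *matches* $F$ if $F(f_\beta)=a_\beta$ whenever $a_\beta\neq\ast$. A *hyper-sequential procedure* is a set $\Omega$ of strings, each with a value in $\mathbb N$, such that for any two different strings $\{(f_\beta,a_\beta)\}_{\beta<\alpha}$ and $\{(f'_\beta,a'_\beta)\}_{\beta<\alpha'}$ in $\Omega$ there is $\beta<\min\{\alpha,\alpha'\}$ with $f_\beta=f'_\beta$, $a_\beta\ne a'_\beta$, $a_\beta\neq\ast\neq a'_\beta$ and $(f_\gamma,a_\gamma)=(f'_\gamma,a'_\gamma)$ for all $\gamma<\beta$. It *defines* the type 3 functional $\Phi$ if for all $F$ and $c$: $\Phi(F)=c$ if and only if some string in $\Omega$ with value $c$ matches $F$.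 A total functional of type 3 is *hyper-sequential* if some hyper-sequential procedure defines it. **Kleene computability.** Let $\vec\Phi=(\Phi_1,\dots,\Phi_n)$ be of type 3, $F$ of type 2, $\vec f$ and $\vec a$ finite sequences from $\mathbb N^{\mathbb N}$ and $\mathbb N$, and let $\langle\cdot\rangle$ be an injective coding of finite sequences of natural numbers. The relation $\{e\}(\vec\Phi,F,\vec f,\vec a)=c$ is the least one closed under the following schemes. - S1: $\{\langle 1\rangle\}(\vec\Phi,F,\vec f,b,\vec a)=b+1$. - S2: $\{\langle 2,q\rangle\}(\vec\Phi,F,\vec f,\vec a)=q$. - S3: $\{\langle 3\rangle\}(\vec\Phi,F,\vec f,b,\vec a)=b$. - S4: $\{\langle 4,e_1,e_2\rangle\}(\vec\Phi,F,\vec f,\vec a)=\{e_1\}(\vec\Phi,F,\vec f,\{e_2\}(\vec\Phi,F,\vec f,\vec a),\vec a)$. - S5: for $e=\langle 5,e_1,e_2\rangle$, $\{e\}(\vec\Phi,F,\vec f,0,\vec a)=\{e_1\}(\vec\Phi,F,\vec f,\vec a)$ and $\{e\}(\vec\Phi,F,\vec f,m+1,\vec a)=\{e_2\}(\vec\Phi,F,\vec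 f,m,\{e\}(\vec\Phi,F,\vec f,m,\vec a),\vec a)$. - S6: $\{\langle 6,e_1,\sigma,\tau\rangle\}(\vec\Phi,F,\vec f,\vec a)=\{e_1\}(\vec\Phi,F,\vec f_\sigma,\vec a_\tau)$ for (codes of) permutations $\sigma,\tau$ of the index sets of $\vec f$ and $\vec a$. - S7: $\{\langle 7\rangle\}(\vec\Phi,F,f,\vec f,b,\vec a)=f(b)$. - S8, type 2: $\{\langle 8,2,d\rangle\}(\vec\Phi,F,\vec f,\vec a)=F(\lambda b.\{d\}(\vec\Phi,F,\vec f,b,\vec a))$, where the argument of $F$ has to be total. - S8, type 3: $\{\langle 8,3,i,d\rangle\}(\vec\Phi,F,\vec f,\vec a)=\Phi_i(\lambda g.\{d\}(\vec\Phi,F,g,\vec f,\vec a))$ for $1\le i\le n$. - S9: $\{\langle 9\rangle\}(\vec\Phi,F,\vec f,d,\vec a)=\{d\}(\vec\Phi,F,\vec f,\vec a)$. The right-hand side of S8 for type 3 is read in one of three ways, where $H$ denotes the possibly partial functional $\lambda g.\{d\}(\vec\Phi,F,g,\vec f,\vec a)$: - (base elements) $\Phi_i(H)=c$ if $H$ is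 defined on a countable set $A\subseteq\mathbb N^{\mathbb N}$ such that $\Phi_i(G)=c$ for every total $G$ that agrees with $H$ on $A$; - (total arguments) $\Phi_i(H)$ is defined only for total $H$, with its given value; - (procedures) for fixed hyper-sequential procedures $\Omega_1,\dots,\Omega_n$ defining $\Phi_1,\dots,\Phi_n$: $\Phi_i(H)=c$ if some string in $\Omega_i$ with value $c$ matches $H$, that is, for every $\beta$ with $a_\beta\neq\ast$, $H(f_\beta)$ is defined and equal to $a_\beta$. **Theorem 3.4.** The class of hyper-sequential functionals of type 3 is closed under relative Kleene computability: let $\Phi_1,\dots,\Phi_n$ be hyper-sequential functionals of type 3, let $e\in\mathbb N$, and let $\vec f$, $\vec a$ be finite sequences from $\mathbb N^{\mathbb N}$ and $\mathbb N$. Under each of the three readings of S8 (in the third one, for every choice of procedures $\Omega_1,\dots,\Omega_n$ defining $\Phi_1,\dots,\Phi_n$), if $\Psi=\lambda F.\{e\}(\vec\Phi,F,\vec f,\vec a)$ is total, then $\Psi$ is hyper-sequential. -/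

import Mathlib

namespace HyperSeq

/-- Functions, the objects of pure type 1. -/
abbrev Tp1 : Type := ℕ → ℕ

/-- Total functionals of pure type 2. -/
abbrev Tp2 : Type := Tp1 → ℕ

/-- Total functionals of pure type 3. -/
abbrev Tp3 : Type := Tp2 → ℕ

/-- A string `(f_β, a_β)_{β < α}` of queries and answers, where `α` is a countable ordinal,
`f_β` is of type 1 and `a_β ∈ ℕ ∪ {∗}`. The extra element `∗` is `none`. -/
structure QString where
  len : Ordinal.{0}
  countable_len : len.card ≤ Cardinal.aleph0
  item : Set.Iio len → Tp1 × Option ℕ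

namespace QString

/-- The string matches `F` if `F f_β = a_β` for all `β` with `a_β ≠ ∗`. -/
def Matches (t : QString) (F : Tp2) : Prop :=
  ∀ (β : Set.Iio t.len) (m : ℕ), (t.item β).2 = some m → F (t.item β).1 = m

/-- The set of those queries `f_β` of the string for which `a_β ≠ ∗`. -/
def asked (t : QString) : Set Tp1 :=
  {g | ∃ (β : Set.Iio t.len) (m : ℕ), t.item β = (g, some m)}

/-- There is a position `β` in both strings before which the strings agree, and at which the
queries are the same while the answers are different and both different from `∗`. -/
def Splits (t t' : QString) : Prop :=
  ∃ (β : Ordinal.{0}) (h : β < t.len) (h' : β < t'.len),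
    (t.item ⟨β, h⟩).1 = (t'.item ⟨β, h'⟩).1 ∧
    (t.item ⟨β, h⟩).2 ≠ (t'.item ⟨β, h'⟩).2 ∧
    (t.item ⟨β, h⟩).2 ≠ none ∧
    (t'.item ⟨β, h'⟩).2 ≠ none ∧
    ∀ (γ : Ordinal.{0}) (hγ : γ < β),
      t.item ⟨γ, hγ.trans h⟩ = t'.item ⟨γ, hγ.trans h'⟩

end QString

/-- Hyper-sequential procedures: sets of strings with a value attached to each of them, any two
different strings in the set being split by an answer. -/
structure IsProcedure (Ω : Set (QString × ℕ)) : Prop where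
  value_unique : ∀ (t : QString) (b b' : ℕ), (t, b) ∈ Ω → (t, b') ∈ Ω → b = b'
  eq_or_splits : ∀ (t t' : QString) (b b' : ℕ), (t, b) ∈ Ω → (t', b') ∈ Ω →
    t = t' ∨ t.Splits t'

/-- `Ω(F) = c`: some string in `Ω` with value `c` matches `F`. -/
def Calculates (Ω : Set (QString × ℕ)) (F : Tp2) (c : ℕ) : Prop :=
  ∃ t : QString, (t, c) ∈ Ω ∧ t.Matches F

/-- The procedure `Ω` defines the total functional `Φ` of type 3. -/
def Defines (Ω : Set (QString × ℕ)) (Φ : Tp3) : Prop :=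
  IsProcedure Ω ∧ ∀ (F : Tp2) (c : ℕ), Calculates Ω F c ↔ Φ F = c

/-- Hyper-sequential total functionals of type 3. -/
def HyperSequential (Φ : Tp3) : Prop :=
  ∃ Ω : Set (QString × ℕ), Defines Ω Φ

/-- The Gödel number `⟨x₁, …, x_k⟩` of a finite sequence. -/
def code (l : List ℕ) : ℕ := Encodable.encode l

/-- The number coding a permutation of the index set of a sequence of length `k`. -/
def permCode {k : ℕ} (σ : Equiv.Perm (Fin k)) : ℕ :=
  code (List.ofFn fun i => (σ i : ℕ))

/-- The permuted sequence `(l_{σ 0}, …, l_{σ (k-1)})`. -/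
def permute {α : Type} (l : List α) (σ : Equiv.Perm (Fin l.length)) : List α :=
  List.ofFn fun i => l.get (σ i)

/-- Kleene computations `{e}(Φ₁, …, Φ_n, F, f₁, …, f_p, a₁, …, a_q) = c` (schemes S1 - S9).
The parameter `App` fixes how the type 3 functionals are applied to partial arguments:
`App i A h c` says that the restriction of `h` to `A` is enough for `Φ_i` to have the value `c`. -/
inductive Computes {n : ℕ} (App : Fin n → Set Tp1 → Tp2 → ℕ → Prop) (F : Tp2) :
    ℕ → List Tp1 → List ℕ → ℕ → Prop
  | s1 (fs : List Tp1) (a : ℕ) (xs : List ℕ) :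
      Computes App F (code [1]) fs (a :: xs) (a + 1)
  | s2 (q : ℕ) (fs : List Tp1) (xs : List ℕ) :
      Computes App F (code [2, q]) fs xs q
  | s3 (fs : List Tp1) (a : ℕ) (xs : List ℕ) :
      Computes App F (code [3]) fs (a :: xs) a
  | s4 (e₁ e₂ : ℕ) (fs : List Tp1) (xs : List ℕ) (b c : ℕ) :
      Computes App F e₂ fs xs b → Computes App F e₁ fs (b :: xs) c →
      Computes App F (code [4, e₁, e₂]) fs xs c
  | s5_zero (e₁ e₂ : ℕ) (fs : List Tp1) (xs : List ℕ) (c : ℕ) :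
      Computes App F e₁ fs xs c →
      Computes App F (code [5, e₁, e₂]) fs (0 :: xs) c
  | s5_succ (e₁ e₂ : ℕ) (fs : List Tp1) (m : ℕ) (xs : List ℕ) (b c : ℕ) :
      Computes App F (code [5, e₁, e₂]) fs (m :: xs) b →
      Computes App F e₂ fs (m :: b :: xs) c →
      Computes App F (code [5, e₁, e₂]) fs ((m + 1) :: xs) c
  | s6 (e₁ : ℕ) (fs : List Tp1) (xs : List ℕ)
      (σ : Equiv.Perm (Fin fs.length)) (τ : Equiv.Perm (Fin xs.length)) (c : ℕ) :
      Computes App F e₁ (permute fs σ) (permute xs τ) c →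
      Computes App F (code [6, e₁, permCode σ, permCode τ]) fs xs c
  | s7 (f : Tp1) (fs : List Tp1) (a : ℕ) (xs : List ℕ) :
      Computes App F (code [7]) (f :: fs) (a :: xs) (f a)
  | s8_two (d : ℕ) (fs : List Tp1) (xs : List ℕ) (g : Tp1) :
      (∀ a : ℕ, Computes App F d fs (a :: xs) (g a)) →
      Computes App F (code [8, 2, d]) fs xs (F g)
  | s8_three (i : Fin n) (d : ℕ) (fs : List Tp1) (xs : List ℕ) (A : Set Tp1) (h : Tp2) (c : ℕ) :
      (∀ g ∈ A, Computes App F d (g :: fs) xs (h g)) → App i A h c →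
      Computes App F (code [8, 3, (i : ℕ) + 1, d]) fs xs c
  | s9 (d : ℕ) (fs : List Tp1) (xs : List ℕ) (c : ℕ) :
      Computes App F d fs xs c →
      Computes App F (code [9]) fs (d :: xs) c

/-- `Φ_i` is applied to total arguments only. -/
def totalApp {n : ℕ} (Φ : Fin n → Tp3) (i : Fin n) (A : Set Tp1) (h : Tp2) (c : ℕ) : Prop :=
  A = Set.univ ∧ Φ i h = c

/-- `Φ_i` is applied to every partial argument that extends a base element of `Φ_i`: a partial
functional with countable domain `A`, on all of whose total extensions `Φ_i` has the same value. -/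
def baseApp {n : ℕ} (Φ : Fin n → Tp3) (i : Fin n) (A : Set Tp1) (h : Tp2) (c : ℕ) : Prop :=
  A.Countable ∧ ∀ G : Tp2, Set.EqOn G h A → Φ i G = c

/-- `Φ_i` is applied to every partial argument matched by a string of the procedure `Ω_i`. -/
def procApp {n : ℕ} (Ω : Fin n → Set (QString × ℕ)) (i : Fin n) (A : Set Tp1) (h : Tp2) (c : ℕ) :
    Prop :=
  ∃ t : QString, (t, c) ∈ Ω i ∧ t.Matches h ∧ A = t.asked

end HyperSeq

open HyperSeq

namespace HyperSeq

/-! Hyper-sequentiality follows from countable support: it suffices that each value `Ψ F` is fixed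
by the values of `F` on a countable set `A F`. While the answers so far leave `Ψ` undecided, pick
two functionals consistent with them on which `Ψ` differs, and query both their supports. One of the
two, `G`, has `Ψ G ≠ Ψ F`, so `F` on `A F` and `G` on `A G` have no common extension; hence the
stage queries a point of `A F` not settled before. As `A F` is countable, every run halts at a
countable ordinal, and the halted runs form the procedure. Computations with base elements have
countable support, as countable sets are closed under countable unions, and are single-valued. The
other two readings reduce to this one by `Computes.mono_app`. -/

theorem countable_Iio_iff {α : Ordinal.{0}} :
    (Set.Iio α).Countable ↔ α.card ≤ Cardinal.aleph0 := by
  rw [← Cardinal.le_aleph0_iff_set_countable, Cardinal.mk_Iio_ordinal, Cardinal.lift_le_aleph0]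

/-! ### Countable support implies hyper-sequentiality -/

section CountableSupport

open Ordinal

/-- The type 2 functionals that agree with `F` on all queries asked before stage `α`, if `q S`
enumerates the queries asked when `S` is the set of functionals agreeing with the answers so far. -/
noncomputable def stage (q : Set Tp2 → ℕ → Tp1) (F : Tp2) (α : Ordinal.{0}) : Set Tp2 :=
  {G | ∀ γ : Set.Iio α, ∀ k : ℕ, G (q (stage q F γ) k) = F (q (stage q F γ) k)}
termination_by α
decreasing_by exact γ.2

variable {q : Set Tp2 → ℕ → Tp1} {F G : Tp2} {α : Ordinal.{0}}

theorem mem_stage : G ∈ stage q F α ↔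
    ∀ γ < α, ∀ k : ℕ, G (q (stage q F γ) k) = F (q (stage q F γ) k) := by
  rw [stage]
  simp [Set.mem_Iio]

/-- Queries depend only on earlier answers, so the runs against `F` and `G` coincide until an answer
differs. -/
theorem stage_congr (h : G ∈ stage q F α) : stage q G α = stage q F α := by
  induction α using WellFoundedLT.induction with
  | ind α ih =>
    rw [mem_stage] at h
    have hs : ∀ γ < α, stage q G γ = stage q F γ := fun γ hγ =>
      ih γ hγ (mem_stage.2 fun δ hδ => h δ (hδ.trans hγ))
    ext K
    simp only [mem_stage]
    refine forall_congr' fun γ => forall_congr' fun hγ => forall_congr' fun k => ?_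
    rw [hs γ hγ, h γ hγ k]

/-- The query at position `β` of the run against `F`; each stage has `ω` queries. -/
noncomputable def query (q : Set Tp2 → ℕ → Tp1) (F : Tp2) (β : Ordinal.{0}) : Tp1 :=
  q (stage q F (β / ω)) (β % ω).card.toNat

/-- The first `N` stages of the run against `F`, as a string. -/
noncomputable def run (q : Set Tp2 → ℕ → Tp1) (F : Tp2) (N : Ordinal.{0})
    (hN : N.card ≤ Cardinal.aleph0) : QString where
  len := ω * N
  countable_len := by
    rw [Ordinal.card_mul, Ordinal.card_omega0]
    exact (mul_le_mul' le_rfl hN).trans Cardinal.aleph0_mul_aleph0.le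
  item β := (query q F β, some (F (query q F β)))

theorem query_mul_add (q : Set Tp2 → ℕ → Tp1) (F : Tp2) (γ : Ordinal.{0}) (k : ℕ) :
    query q F (ω * γ + k) = q (stage q F γ) k := by
  have hk : (k : Ordinal.{0}) < ω := Ordinal.natCast_lt_omega0 k
  rw [query, Ordinal.mul_add_div _ omega0_ne_zero, Ordinal.div_eq_zero_of_lt hk, add_zero,
    Ordinal.mul_add_mod_self, Ordinal.mod_eq_of_lt hk]
  simp

theorem mem_stage_iff_query {N : Ordinal.{0}} : G ∈ stage q F N ↔
    ∀ β < ω * N, G (query q F β) = F (query q F β) := by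
  rw [mem_stage]
  constructor
  · intro h β hβ
    exact h _ ((Ordinal.lt_mul_iff_div_lt omega0_ne_zero).1 hβ) _
  · intro h γ hγ k
    rw [← query_mul_add q F γ k]
    refine h _ ?_
    rw [Ordinal.lt_mul_iff_div_lt omega0_ne_zero, Ordinal.mul_add_div _ omega0_ne_zero,
      Ordinal.div_eq_zero_of_lt (Ordinal.natCast_lt_omega0 k), add_zero]
    exact hγ

theorem run_matches_iff {N : Ordinal.{0}} {hN : N.card ≤ Cardinal.aleph0} :
    (run q F N hN).Matches G ↔ G ∈ stage q F N := by
  rw [mem_stage_iff_query]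
  constructor
  · intro h β hβ
    exact h ⟨β, hβ⟩ _ rfl
  · rintro h ⟨β, hβ⟩ m hm
    cases hm
    exact h β hβ

/-- A functional of type 3 is hyper-sequential if each of its values is determined by countably
many values of the argument. -/
theorem hyperSequential_of_countable_support {Ψ : Tp3}
    (hΨ : ∀ F : Tp2, ∃ A : Set Tp1, A.Countable ∧ ∀ G : Tp2, Set.EqOn G F A → Ψ G = Ψ F) :
    HyperSequential Ψ := by
  choose A hA hAΨ using hΨ
  let Const : Set Tp2 → Prop := fun S => ∀ F ∈ S, ∀ G ∈ S, Ψ F = Ψ G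
  have hq : ∀ S : Set Tp2, ∃ q : ℕ → Tp1, ¬ Const S → ∃ F ∈ S, ∃ G ∈ S, Ψ F ≠ Ψ G ∧
      A F ⊆ Set.range q ∧ A G ⊆ Set.range q := by
    intro S
    by_cases hS : Const S
    · exact ⟨fun _ _ => 0, fun h => absurd hS h⟩
    · simp only [Const, not_forall] at hS
      obtain ⟨F, hF, G, hG, hne⟩ := hS
      -- The zero function only makes the set nonempty, so that it has an enumeration.
      obtain ⟨q, hq⟩ := (((hA F).union (hA G)).insert (fun _ => 0)).exists_eq_range
        (Set.insert_nonempty _ _)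
      refine ⟨q, fun _ => ⟨F, hF, G, hG, hne, ?_, ?_⟩⟩ <;> rw [← hq] <;>
        intro x hx <;> simp [hx]
  choose q hq using hq
  have progress : ∀ (F : Tp2) (α : Ordinal.{0}), ¬ Const (stage q F α) →
      ∃ p ∈ A F, p ∈ Set.range (q (stage q F α)) ∧ ∃ G ∈ stage q F α, G p ≠ F p := by
    intro F α hα
    obtain ⟨G, hG, hGF, hsub⟩ : ∃ G ∈ stage q F α, Ψ G ≠ Ψ F ∧
        A G ⊆ Set.range (q (stage q F α)) := by
      obtain ⟨G, hG, K, hK, hne, hsG, hsK⟩ := hq _ hα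
      by_cases h : Ψ G = Ψ F
      · exact ⟨K, hK, fun h' => hne (h.trans h'.symm), hsK⟩
      · exact ⟨G, hG, h, hsG⟩
    -- Otherwise `F` and `G` agree on `A F ∩ A G`, and `K` takes the value of `Ψ` at both.
    by_contra! hcon
    classical
    let K : Tp2 := (A F).piecewise F G
    have h₁ : Ψ K = Ψ F := hAΨ F K (Set.piecewise_eqOn _ _ _)
    have h₂ : Ψ K = Ψ G := by
      refine hAΨ G K fun p hp => ?_
      by_cases hpF : p ∈ A F
      · simp only [K, Set.piecewise_eq_of_mem _ _ _ hpF]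
        exact (hcon p hpF (hsub hp) G hG).symm
      · simp only [K, Set.piecewise_eq_of_notMem _ _ _ hpF]
    exact hGF (h₂.symm.trans h₁)
  choose! p hpA hpq hpG using progress
  have hinj : ∀ F : Tp2, Set.InjOn (p F) {α | ¬ Const (stage q F α)} := by
    intro F
    -- A point queried at stage `γ` has its value fixed at all later stages, so it cannot be new at
    -- `α`.
    have key : ∀ γ α : Ordinal.{0}, γ < α → ¬ Const (stage q F γ) → ¬ Const (stage q F α) →
        p F γ ≠ p F α := by
      intro γ α hγα hγ hα heq
      obtain ⟨k, hk⟩ := hpq F γ hγ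
      obtain ⟨G, hG, hne⟩ := hpG F α hα
      have := mem_stage.1 hG γ hγα k
      rw [hk, heq] at this
      exact hne this
    intro γ hγ α hα heq
    rcases lt_trichotomy γ α with h | h | h
    · exact absurd heq (key γ α h hγ hα)
    · exact h
    · exact absurd heq.symm (key α γ h hα hγ)
  have hhalt : ∀ F : Tp2, ∃ N : Ordinal.{0}, Const (stage q F N) ∧
      (∀ α < N, ¬ Const (stage q F α)) ∧ N.card ≤ Cardinal.aleph0 := by
    intro F
    have hex : ∃ N : Ordinal.{0}, Const (stage q F N) := by
      by_contra! hcon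
      -- A run that never halts would inject all ordinals into `Tp1`.
      refine not_injective_of_ordinal (p F) fun γ α h => hinj F (hcon γ) (hcon α) h
    obtain ⟨N, hN, hmin⟩ := WellFounded.has_min (r := ((· < ·) : Ordinal.{0} → Ordinal.{0} → Prop))
      wellFounded_lt {N | Const (stage q F N)} hex
    have hmin' : ∀ α < N, ¬ Const (stage q F α) := fun α hα h => hmin α h hα
    refine ⟨N, hN, hmin', ?_⟩
    have hc : (Set.Iio N).Countable :=
      Set.MapsTo.countable_of_injOn (t := A F) (fun α hα => hpA F α (hmin' α hα))
        (fun γ hγ α hα h => hinj F (hmin' γ hγ) (hmin' α hα) h) (hA F)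
    exact countable_Iio_iff.1 hc
  choose N hNc hNmin hNcard using hhalt
  let w : Tp2 → QString := fun F => run q F (N F) (hNcard F)
  have hlt : ∀ F G α, α < N F → G ∈ stage q F α → α < N G := by
    intro F G α hα hG
    by_contra! hle
    have hG' : G ∈ stage q F (N G) := mem_stage.2 fun γ hγ => mem_stage.1 hG γ (hγ.trans_le hle)
    have := hNc G
    rw [stage_congr hG'] at this
    exact hNmin F _ (hle.trans_lt hα) this
  have hval : ∀ F G, (w F).Matches G → Ψ G = Ψ F := fun F G h =>
    hNc F G (run_matches_iff.1 h) F (mem_stage.2 fun _ _ _ => rfl)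
  have hself : ∀ F, (w F).Matches F := fun F => run_matches_iff.2 (mem_stage.2 fun _ _ _ => rfl)
  have hquery : ∀ F G β, G ∈ stage q F (β / ω) → query q G β = query q F β := by
    intro F G β h
    rw [query, query, stage_congr h]
  refine ⟨{x | ∃ F, x = (w F, Ψ F)}, ⟨?_, ?_⟩, ?_⟩
  · rintro t b b' ⟨F, hF⟩ ⟨G, hG⟩
    simp only [Prod.mk.injEq] at hF hG
    rw [hF.2, hG.2]
    exact hval G F (hG.1 ▸ hF.1 ▸ hself F)
  · rintro t t' b b' ⟨F, hF⟩ ⟨G, hG⟩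
    simp only [Prod.mk.injEq] at hF hG
    rw [hF.1, hG.1]
    by_cases hagree : G ∈ stage q F (N F)
    · left
      have hmem : ∀ α ≤ N F, G ∈ stage q F α := fun α hα =>
        mem_stage.2 fun γ hγ => mem_stage.1 hagree γ (hγ.trans_le hα)
      have hNN : N G = N F := by
        refine le_antisymm ?_ ?_
        · by_contra! h
          exact hNmin G _ h (stage_congr hagree ▸ hNc F)
        · by_contra! h
          exact absurd (hlt F G _ h (hmem _ h.le)) (lt_irrefl _)
      have hitem : ∀ β < ω * N F, (query q F β, some (F (query q F β))) =
          (query q G β, some (G (query q G β))) := by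
        intro β hβ
        have hα : β / ω < N F := (Ordinal.lt_mul_iff_div_lt omega0_ne_zero).1 hβ
        rw [hquery F G β (hmem _ hα.le), mem_stage_iff_query.1 hagree β hβ]
      simp only [w, run, QString.mk.injEq, hNN, true_and]
      refine Function.hfunext (by rw [hNN]) ?_
      rintro ⟨β, hβ⟩ ⟨β', hβ'⟩ h
      have : β = β' := by
        revert hβ' h
        rw [hNN]
        intro hβ' h
        exact congrArg Subtype.val (eq_of_heq h)
      subst this
      exact heq_of_eq (hitem β hβ)
    · right
      rw [mem_stage_iff_query] at hagree
      push Not at hagree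
      -- The strings split at the first differing answer; its query is the same in both, since the
      -- stage containing `β` starts at `ω * (β / ω) ≤ β`.
      obtain ⟨β, ⟨hβ, hne⟩, hmin⟩ := WellFounded.has_min
        (r := ((· < ·) : Ordinal.{0} → Ordinal.{0} → Prop)) wellFounded_lt
        {β | β < ω * N F ∧ G (query q F β) ≠ F (query q F β)} hagree
      have heq : ∀ γ < β, G (query q F γ) = F (query q F γ) := by
        intro γ hγ
        by_contra h
        exact hmin γ ⟨hγ.trans hβ, h⟩ hγ
      have hmem : ∀ γ ≤ β, G ∈ stage q F (γ / ω) := fun γ hγ =>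
        mem_stage_iff_query.2 fun δ hδ =>
          heq δ (hδ.trans_le ((Ordinal.mul_div_le γ ω).trans hγ))
      have hβF : β / ω < N F := (Ordinal.lt_mul_iff_div_lt omega0_ne_zero).1 hβ
      have hβG : β < ω * N G :=
        (Ordinal.lt_mul_iff_div_lt omega0_ne_zero).2 (hlt F G _ hβF (hmem β le_rfl))
      refine ⟨β, hβ, hβG, ?_, ?_, ?_, ?_, ?_⟩
      · exact (hquery F G β (hmem β le_rfl)).symm
      · simp only [w, run, hquery F G β (hmem β le_rfl), ne_eq, Option.some.injEq]
        exact fun h => hne h.symm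
      · simp [w, run]
      · simp [w, run]
      · intro γ hγ
        simp only [w, run, hquery F G γ (hmem γ hγ.le), heq γ hγ]
  · intro F c
    constructor
    · rintro ⟨t, ⟨G, hG⟩, ht⟩
      simp only [Prod.mk.injEq] at hG
      rw [hG.2]
      exact hval G F (hG.1 ▸ ht)
    · rintro rfl
      exact ⟨w F, ⟨F, rfl⟩, hself F⟩

end CountableSupport

/-! ### Kleene computations over base elements -/

theorem code_inj {l l' : List ℕ} : code l = code l' ↔ l = l' :=
  Encodable.encode_injective.eq_iff

theorem permCode_injective {k : ℕ} : Function.Injective (permCode (k := k)) := by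
  intro σ τ h
  rw [permCode, permCode, code_inj, List.ofFn_inj] at h
  ext i
  exact congrFun h i

theorem QString.countable_asked (t : QString) : t.asked.Countable := by
  have : Countable (Set.Iio t.len) := (countable_Iio_iff.2 t.countable_len).to_subtype
  refine (Set.countable_range fun β => (t.item β).1).mono ?_
  rintro g ⟨β, m, h⟩
  exact ⟨β, by simp [h]⟩

theorem QString.Matches.congr {t : QString} {F G : Tp2} (h : t.Matches F)
    (hFG : Set.EqOn G F t.asked) : t.Matches G := fun β m hm => by
  rw [hFG ⟨β, m, Prod.ext rfl hm⟩]
  exact h β m hm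

variable {n : ℕ} {Φ : Fin n → Tp3} {F : Tp2} {e : ℕ} {fs : List Tp1} {xs : List ℕ} {c : ℕ}

/-- Kleene computations are monotone in the rule for applying the type 3 functionals. -/
theorem Computes.mono_app {App App' : Fin n → Set Tp1 → Tp2 → ℕ → Prop}
    (hApp : ∀ i A h c, App i A h c → ∃ B ⊆ A, App' i B h c)
    (H : Computes App F e fs xs c) : Computes App' F e fs xs c := by
  induction H with
  | s1 => exact .s1 ..
  | s2 => exact .s2 ..
  | s3 => exact .s3 ..
  | s4 _ _ _ _ _ _ _ _ ih₁ ih₂ => exact .s4 _ _ _ _ _ _ ih₁ ih₂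
  | s5_zero _ _ _ _ _ _ ih => exact .s5_zero _ _ _ _ _ ih
  | s5_succ _ _ _ _ _ _ _ _ _ ih₁ ih₂ => exact .s5_succ _ _ _ _ _ _ _ ih₁ ih₂
  | s6 _ _ _ _ _ _ _ ih => exact .s6 _ _ _ _ _ _ ih
  | s7 => exact .s7 ..
  | s8_two _ _ _ _ _ ih => exact .s8_two _ _ _ _ ih
  | s8_three i _ _ _ A h c _ hA ih =>
    obtain ⟨B, hB, hB'⟩ := hApp i A h c hA
    exact .s8_three _ _ _ _ B h _ (fun g hg => ih g (hB hg)) hB'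
  | s9 _ _ _ _ _ ih => exact .s9 _ _ _ _ ih

/-- The value of a computation depends on countably many values of the type 2 argument only. -/
theorem Computes.exists_countable_support (H : Computes (baseApp Φ) F e fs xs c) :
    ∃ A : Set Tp1, A.Countable ∧
      ∀ G : Tp2, Set.EqOn G F A → Computes (baseApp Φ) G e fs xs c := by
  induction H with
  | s1 => exact ⟨∅, Set.countable_empty, fun _ _ => .s1 ..⟩
  | s2 => exact ⟨∅, Set.countable_empty, fun _ _ => .s2 ..⟩
  | s3 => exact ⟨∅, Set.countable_empty, fun _ _ => .s3 ..⟩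
  | s4 _ _ _ _ _ _ _ _ ih₁ ih₂ =>
    obtain ⟨A, hA, h₁⟩ := ih₁
    obtain ⟨B, hB, h₂⟩ := ih₂
    exact ⟨A ∪ B, hA.union hB, fun G hG => .s4 _ _ _ _ _ _
      (h₁ G (hG.mono Set.subset_union_left)) (h₂ G (hG.mono Set.subset_union_right))⟩
  | s5_zero _ _ _ _ _ _ ih =>
    obtain ⟨A, hA, h⟩ := ih
    exact ⟨A, hA, fun G hG => .s5_zero _ _ _ _ _ (h G hG)⟩
  | s5_succ _ _ _ _ _ _ _ _ _ ih₁ ih₂ =>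
    obtain ⟨A, hA, h₁⟩ := ih₁
    obtain ⟨B, hB, h₂⟩ := ih₂
    exact ⟨A ∪ B, hA.union hB, fun G hG => .s5_succ _ _ _ _ _ _ _
      (h₁ G (hG.mono Set.subset_union_left)) (h₂ G (hG.mono Set.subset_union_right))⟩
  | s6 _ _ _ _ _ _ _ ih =>
    obtain ⟨A, hA, h⟩ := ih
    exact ⟨A, hA, fun G hG => .s6 _ _ _ _ _ _ (h G hG)⟩
  | s7 => exact ⟨∅, Set.countable_empty, fun _ _ => .s7 ..⟩
  | s8_two d fs xs g _ ih =>
    choose A hA h using ih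
    refine ⟨insert g (⋃ a, A a), (Set.countable_iUnion hA).insert g, fun G hG => ?_⟩
    rw [← hG (Set.mem_insert _ _)]
    exact .s8_two _ _ _ _ fun a => h a G
      (hG.mono ((Set.subset_iUnion A a).trans (Set.subset_insert _ _)))
  | s8_three i d fs xs B h c _ hB ih =>
    choose! A hA hG using ih
    -- This union is countable because the domain `B` of the base element is.
    exact ⟨⋃ g ∈ B, A g, hB.1.biUnion hA, fun G hGF => .s8_three _ _ _ _ B h _
      (fun g hg => hG g hg G (hGF.mono (Set.subset_biUnion_of_mem hg))) hB⟩
  | s9 _ _ _ _ _ ih =>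
    obtain ⟨A, hA, h⟩ := ih
    exact ⟨A, hA, fun G hG => .s9 _ _ _ _ (h G hG)⟩

/-- Computations have at most one value. -/
theorem Computes.unique (H : Computes (baseApp Φ) F e fs xs c) {c' : ℕ}
    (H' : Computes (baseApp Φ) F e fs xs c') : c = c' := by
  induction H generalizing c' with
  | s1 fs a xs =>
    -- With the index a variable, `cases` applies; injectivity of `code` then excludes the other
    -- schemes.
    generalize he : code [1] = e' at H'
    cases H' <;> simp [code_inj] at he
    rfl
  | s2 q fs xs =>
    generalize he : code [2, q] = e' at H'
    cases H' <;> simp [code_inj] at he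
    exact he
  | s3 fs a xs =>
    generalize he : code [3] = e' at H'
    cases H' <;> simp [code_inj] at he
    rfl
  | s4 e₁ e₂ fs xs b c _ _ ih₁ ih₂ =>
    generalize he : code [4, e₁, e₂] = e' at H'
    cases H' <;> simp [code_inj] at he
    obtain ⟨rfl, rfl⟩ := he
    rename_i h₂ h₁
    cases ih₁ h₁
    exact ih₂ h₂
  | s5_zero e₁ e₂ fs xs c _ ih =>
    generalize he : code [5, e₁, e₂] = e' at H'
    cases H' <;> simp [code_inj] at he
    obtain ⟨rfl, rfl⟩ := he
    rename_i h
    exact ih h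
  | s5_succ e₁ e₂ fs m xs b c _ _ ih₁ ih₂ =>
    generalize he : code [5, e₁, e₂] = e' at H'
    cases H' <;> simp [code_inj] at he
    obtain ⟨rfl, rfl⟩ := he
    rename_i h₂ h₁
    cases ih₁ h₁
    exact ih₂ h₂
  | s6 e₁ fs xs σ τ c _ ih =>
    generalize he : code [6, e₁, permCode σ, permCode τ] = e' at H'
    cases H' <;> simp [code_inj, permCode_injective.eq_iff] at he
    obtain ⟨rfl, rfl, rfl⟩ := he
    rename_i h
    exact ih h
  | s7 f fs a xs =>
    generalize he : code [7] = e' at H'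
    cases H' <;> simp [code_inj] at he
    rfl
  | s8_two d fs xs g _ ih =>
    generalize he : code [8, 2, d] = e' at H'
    cases H' <;> simp [code_inj] at he
    subst he
    rename_i g' h
    exact congrArg F (funext fun a => ih a (h a))
  | s8_three i d fs xs A h c _ hA ih =>
    generalize he : code [8, 3, (i : ℕ) + 1, d] = e' at H'
    cases H' <;> simp [code_inj] at he
    rename_i j d' B k hk hB
    obtain ⟨hij, rfl⟩ := he
    cases Fin.ext hij
    classical
    -- By induction the two base elements agree on `A ∩ B`, so one total functional extends both.
    have h₁ := hA.2 (A.piecewise h k) (Set.piecewise_eqOn _ _ _)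
    have h₂ := hB.2 (A.piecewise h k) fun g hg => by
      by_cases hgA : g ∈ A
      · rw [Set.piecewise_eq_of_mem _ _ _ hgA]
        exact ih g hgA (hk g hg)
      · rw [Set.piecewise_eq_of_notMem _ _ _ hgA]
    exact h₁.symm.trans h₂
  | s9 d fs xs c _ ih =>
    generalize he : code [9] = e' at H'
    cases H' <;> simp [code_inj] at he
    rename_i h
    exact ih h

theorem hyperSequential_of_computes_baseApp {Ψ : Tp3}
    (H : ∀ F : Tp2, Computes (baseApp Φ) F e fs xs (Ψ F)) : HyperSequential Ψ := by
  refine hyperSequential_of_countable_support fun F => ?_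
  obtain ⟨A, hA, hAF⟩ := (H F).exists_countable_support
  exact ⟨A, hA, fun G hG => (H G).unique (hAF G hG)⟩

theorem baseApp_of_matches {Ω : Set (QString × ℕ)} {i : Fin n} (hΩ : Defines Ω (Φ i))
    {t : QString} (ht : (t, c) ∈ Ω) {h : Tp2} (hm : t.Matches h) : baseApp Φ i t.asked h c :=
  ⟨t.countable_asked, fun G hG => (hΩ.2 G c).1 ⟨t, ht, hm.congr hG⟩⟩

end HyperSeq

open HyperSeq
theorem theorem3p4 (n : ℕ) (Φ : Fin n → Tp3) (hΦ : ∀ i, HyperSequential (Φ i))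
    (e : ℕ) (fs : List Tp1) (xs : List ℕ) (Ψ : Tp3) :
    ((∀ F : Tp2, Computes (baseApp Φ) F e fs xs (Ψ F)) → HyperSequential Ψ) ∧
    ((∀ F : Tp2, Computes (totalApp Φ) F e fs xs (Ψ F)) → HyperSequential Ψ) ∧
    (∀ Ω : Fin n → Set (QString × ℕ), (∀ i, Defines (Ω i) (Φ i)) →
      (∀ F : Tp2, Computes (procApp Ω) F e fs xs (Ψ F)) → HyperSequential Ψ) := by
  refine ⟨hyperSequential_of_computes_baseApp, fun H => ?_, fun Ω hΩ H => ?_⟩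
  · refine hyperSequential_of_computes_baseApp (Φ := Φ) fun F => (H F).mono_app ?_
    rintro i A h c ⟨rfl, hc⟩
    -- A string matching the total argument cuts it down to a base element.
    obtain ⟨Ω, hΩ⟩ := hΦ i
    obtain ⟨t, ht, hm⟩ := (hΩ.2 h c).2 hc
    exact ⟨t.asked, Set.subset_univ _, baseApp_of_matches hΩ ht hm⟩
  · refine hyperSequential_of_computes_baseApp (Φ := Φ) fun F => (H F).mono_app ?_
    rintro i A h c ⟨t, ht, hm, rfl⟩
    exact ⟨t.asked, subset_rfl, baseApp_of_matches (hΩ i) ht hm⟩
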